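/- Let $\nu>0$ and $0<T<\infty$, and write $\Gamma f=\partial_t f+u\cdot\nabla f-\nu\Delta f$. All vector fields $f=u,A,v:[0,T)\times\mathbb R^3\to\mathbb R^3$ below are assumed to be $C^\infty$ on $(0,T)\times\mathbb R^3$, differentiable in $x$ at each $t\in[0,T)$, with $f$ and $\nabla f$ continuous on $[0,T)\times\mathbb R^3$ and $\nabla f$ bounded on $[0,T']\times\mathbb R^3$ for every $T'<T$. Repeated indices are summed over $\{1,2,3\}$. Suppose that: (i) $u$ solves the incompressible Navier–Stokes equations on $(0,T)\times\mathbb R^3$, i.e. $\Gamma u+\nabla p=0$ and $\nabla\cdot u=0$ for some pressure $p$ that is smooth in $x$ for each $t$; (ii) $A$ solves the diffusive label equation $\Gamma A=0$ on $(0,T)\times\mathbb R^3$, $A(x,0)=x$, and the matrix $\nabla A=(\partial_jA^m)_{m,j}$ is invertible at every point of $[0,T)\times\mathbb R^3$; put $Q=(\nabla A)^{-1}$, $\nabla^A_i=Q_{ji}\partial_j$ and $C^m_{k;i}=\nabla^A_i(\partial_kA^m)$; (iii) $v$ solves the virtual-velocity equation $\Gamma v_i=2\nu\, C^m_{k;i}\,\partial_k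 v_m$ on $(0,T)\times\mathbb R^3$, with $v(x,0)=u(x,0)$. Let $\omega=\nabla\times u$ and $\zeta=\nabla^A\times v$, that is $\zeta_q=\epsilon_{qij}\nabla^A_iv_j$. Then on $[0,T)\times\mathbb R^3$ the viscous Cauchy formula $$\omega_q=\tfrac12\,\epsilon_{qij}\,\mathrm{Det}\left[\zeta;\ \frac{\partial A}{\partial x_i};\ \frac{\partial A}{\partial x_j}\right],\qquad q=1,2,3,$$ holds, where $\mathrm{Det}[a;b;c]$ is the determinant of the matrix formed by the vectors $a,b,c$, and equivalently $$\omega=\mathrm{Det}(\nabla A)\,(\nabla A)^{-1}\zeta .$$ -/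

import Mathlib

open Set
open scoped ContDiff Matrix

noncomputable section

namespace DiffusiveLagrangian

/-- Euclidean three-space. -/
abbrev E3 : Type := EuclideanSpace ℝ (Fin 3)

/-- The `i`-th partial derivative of a scalar function on three-space. -/
def pd (i : Fin 3) (f : E3 → ℝ) (x : E3) : ℝ :=
  fderiv ℝ f x (EuclideanSpace.single i 1)

/-- The permutation symbol `ε_{ijk}`: the determinant of the matrix with rows `e_i, e_j, e_k`,
that is the sign of `(0,1,2) ↦ (i,j,k)` if this is a permutation, and `0` otherwise. -/
def eps (i j k : Fin 3) : ℝ :=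
  ((1 : Matrix (Fin 3) (Fin 3) ℝ).submatrix ![i, j, k] id).det

/-- `Det [a; b; c]`, the determinant of the matrix formed by three vectors. -/
def det3 (a b c : Fin 3 → ℝ) : ℝ := (Matrix.of ![a, b, c]).det

/-- The Eulerian curl, `(∇ × f)_q = ε_{qij} ∂_i f_j`. -/
def curl (f : E3 → E3) (x : E3) : Fin 3 → ℝ :=
  fun q => ∑ i, ∑ j, eps q i j * pd i (fun y => f y j) x

/-- `∂F / ∂x_j`, a vector. -/
def pdVec (j : Fin 3) (F : E3 → E3) (x : E3) : Fin 3 → ℝ :=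
  fun m => pd j (fun y => F y m) x

/-- The gradient matrix of a map: its `(m, j)` entry is `∂_j F^m`. -/
def gradMat (F : E3 → E3) (x : E3) : Matrix (Fin 3) (Fin 3) ℝ :=
  Matrix.of fun m j => pd j (fun y => F y m) x

/-- The Eulerian-Lagrangian derivative of a scalar function at a fixed time,
`∇^A_i f = Q_{ji} ∂_j f`, with `Q = (∇A)⁻¹`. -/
def labelPd (A : E3 → E3) (i : Fin 3) (f : E3 → ℝ) (x : E3) : ℝ :=
  ∑ j, (gradMat A x)⁻¹ j i * pd j f x

/-- The commutator coefficients `C^m_{k;i} = ∇^A_i (∂_k A^m)`. -/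
def commCoeff (A : E3 → E3) (m k i : Fin 3) (x : E3) : ℝ :=
  labelPd A i (pd k (fun y => A y m)) x

/-- The Eulerian-Lagrangian curl, `(∇^A × v)_q = ε_{qij} ∇^A_i v_j`. -/
def labelCurl (A v : E3 → E3) (x : E3) : Fin 3 → ℝ :=
  fun q => ∑ i, ∑ j, eps q i j * labelPd A i (fun y => v y j) x

/-- The operator `Γ_ν(u, ∇) = ∂_t + u · ∇ - ν Δ`, applied to a time-dependent scalar `f`. -/
def Gam (ν : ℝ) (u : ℝ → E3 → E3) (f : ℝ → E3 → ℝ) (t : ℝ) (x : E3) : ℝ :=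
  deriv (fun s => f s x) t + ∑ k, u t x k * pd k (f t) x - ν * Laplacian.laplacian (f t) x

/-- The class of time-dependent vector fields on `[0, T) × ℝ³` in which solutions are understood:
smooth at positive times, continuously differentiable in space up to the initial time, with
spatial gradient bounded on `[0, T'] × ℝ³` for every `T' < T`. -/
structure ClassicalField (T : ℝ) (f : ℝ → E3 → E3) : Prop where
  smooth : ContDiffOn ℝ ∞ (fun z : ℝ × E3 => f z.1 z.2) (Ioo 0 T ×ˢ univ)
  diff : ∀ t ∈ Ico 0 T, Differentiable ℝ (f t)
  cont : ContinuousOn (fun z : ℝ × E3 => f z.1 z.2) (Ico 0 T ×ˢ univ)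
  cont_grad : ContinuousOn (fun z : ℝ × E3 => fderiv ℝ (f z.1) z.2) (Ico 0 T ×ˢ univ)
  bdd_grad : ∀ T' < T, ∃ K : ℝ, ∀ t ∈ Icc 0 T', ∀ x, ‖fderiv ℝ (f t) x‖ ≤ K

/-- `(u, p)` is a classical solution on `[0, T) × ℝ³` of the incompressible Navier-Stokes
equations `∂_t u + u · ∇u - ν Δu + ∇p = 0`, `∇ · u = 0`. -/
structure NavierStokes (ν T : ℝ) (u : ℝ → E3 → E3) (p : ℝ → E3 → ℝ) : Prop where
  field : ClassicalField T u
  pressure : ∀ t ∈ Ioo 0 T, ContDiff ℝ ∞ (p t)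
  momentum : ∀ t ∈ Ioo 0 T, ∀ x, ∀ i,
    Gam ν u (fun s y => u s y i) t x + pd i (p t) x = 0
  div_free : ∀ t ∈ Ioo 0 T, ∀ x, ∑ i, pd i (fun y => u t y i) x = 0

/-- `A` is the diffusive label map of `u` on `[0, T) × ℝ³`: `Γ_ν(u, ∇) A = 0`, `A(x, 0) = x`,
on a time interval on which the matrix `∇A` stays invertible. -/
structure DiffusiveLabel (ν T : ℝ) (u A : ℝ → E3 → E3) : Prop where
  field : ClassicalField T A
  eqn : ∀ t ∈ Ioo 0 T, ∀ x, ∀ m, Gam ν u (fun s y => A s y m) t x = 0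
  init : ∀ x, A 0 x = x
  invertible : ∀ t ∈ Ico 0 T, ∀ x, IsUnit (gradMat (A t) x)

/-- `v` is the virtual velocity of `u` and `A` on `[0, T) × ℝ³`:
`Γ_ν(u, ∇) v_i = 2 ν C^m_{k;i} ∂_k v_m`, with initial datum that of `u`. -/
structure VirtualVelocity (ν T : ℝ) (u A v : ℝ → E3 → E3) : Prop where
  field : ClassicalField T v
  eqn : ∀ t ∈ Ioo 0 T, ∀ x, ∀ i, Gam ν u (fun s y => v s y i) t x =
    2 * ν * ∑ m, ∑ k, commCoeff (A t) m k i x * pd k (fun y => v t y m) x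
  init : ∀ x, v 0 x = u 0 x

end DiffusiveLagrangian

end

open scoped Topology

namespace DiffusiveLagrangian

/-! The proof works with the Weber covector `W_j = v_m ∂_j A^m`. In `Γ W_j` the source term of the
virtual velocity cancels the cross term `-2ν ∂_k v_m ∂_k ∂_j A^m` of the product rule, and commuting
`Γ` with `∂_j` leaves `Γ W_j = -(∂_j u_k) W_k` (`Gam_weber`). The velocity obeys the same equation
up to a gradient, so the curl of `W - u` is free of pressure and solves the linear homogeneous
system `Γ b_ij = -(∂_i u_k) b_kj - (∂_j u_k) b_ik` (`Gam_cauchyDefect`). It vanishes at time zero,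
where `A` is the identity and `v = u`.

Uniqueness is a maximum principle for `|b|²`, with `Γ |b|² ≤ 12 K |b|²` when `|∂_i u_j| ≤ K`
(`nonpos_of_subsolution`, `cauchyDefect_eq_zero`). Passing to the curl matters here: `b` is built
from first derivatives and so is bounded on `[0, T']`, whereas `u`, `v` and `A` may grow linearly in
space.

Thus the curl of `u` is that of `W`, with entries `∂_i v_m ∂_j A^m - ∂_j v_m ∂_i A^m`. Expanding
`∂_i v_m` in the label derivatives makes these the 2×2 minors of `∇A` contracted with `ζ`, that is
`adj(∇A) ζ` (`cauchy_formula`). -/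

/-- Joint smoothness of a time-dependent scalar function at positive times. -/
def SmoothOn (T : ℝ) (f : ℝ → E3 → ℝ) : Prop :=
  ContDiffOn ℝ ∞ (fun z : ℝ × E3 => f z.1 z.2) (Ioo 0 T ×ˢ univ)

lemma isOpen_slab (T : ℝ) : IsOpen (Ioo 0 T ×ˢ (univ : Set E3)) :=
  isOpen_Ioo.prod isOpen_univ

lemma mem_slab {T t : ℝ} (ht : t ∈ Ioo 0 T) (x : E3) : (t, x) ∈ Ioo 0 T ×ˢ (univ : Set E3) :=
  ⟨ht, mem_univ x⟩

lemma minSmoothness_two_le : minSmoothness ℝ 2 ≤ (∞ : WithTop ℕ∞) := by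
  rw [minSmoothness_of_isRCLikeNormedField]
  exact WithTop.coe_le_coe.2 (le_top : (2 : ℕ∞) ≤ ⊤)

/-! ### Partial derivatives in space -/

section Space

variable {f g : E3 → ℝ} {x : E3}

lemma pd_add (i : Fin 3) (hf : DifferentiableAt ℝ f x) (hg : DifferentiableAt ℝ g x) :
    pd i (fun y => f y + g y) x = pd i f x + pd i g x := by
  simp [pd, fderiv_fun_add hf hg]

lemma pd_sub (i : Fin 3) (hf : DifferentiableAt ℝ f x) (hg : DifferentiableAt ℝ g x) :
    pd i (fun y => f y - g y) x = pd i f x - pd i g x := by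
  simp [pd, fderiv_fun_sub hf hg]

lemma pd_mul (i : Fin 3) (hf : DifferentiableAt ℝ f x) (hg : DifferentiableAt ℝ g x) :
    pd i (fun y => f y * g y) x = pd i f x * g x + f x * pd i g x := by
  simp [pd, fderiv_fun_mul hf hg]; ring

lemma pd_const_mul (i : Fin 3) (c : ℝ) (hf : DifferentiableAt ℝ f x) :
    pd i (fun y => c * f y) x = c * pd i f x := by
  simp [pd, fderiv_const_mul hf]

lemma pd_sum {ι : Type*} [Fintype ι] (i : Fin 3) {F : ι → E3 → ℝ}
    (hF : ∀ k, DifferentiableAt ℝ (F k) x) :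
    pd i (fun y => ∑ k, F k y) x = ∑ k, pd i (F k) x := by
  simp [pd, fderiv_fun_sum (fun k _ => hF k)]

lemma contDiff_pd (i : Fin 3) (hf : ContDiff ℝ ∞ f) : ContDiff ℝ ∞ (pd i f) :=
  (hf.fderiv_right (m := ∞) le_rfl).clm_apply contDiff_const

lemma pd_pd (i j : Fin 3) (hf : ContDiff ℝ ∞ f) :
    pd i (pd j f) x =
      fderiv ℝ (fderiv ℝ f) x (EuclideanSpace.single i 1) (EuclideanSpace.single j 1) := by
  have h : DifferentiableAt ℝ (fderiv ℝ f) x :=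
    (hf.fderiv_right (m := ∞) le_rfl).differentiable (by simp) x
  have : pd j f = fun y => fderiv ℝ f y (EuclideanSpace.single j 1) := rfl
  rw [pd, this, fderiv_clm_apply h (differentiableAt_const _)]
  simp

lemma pd_comm (i j : Fin 3) (hf : ContDiff ℝ ∞ f) : pd i (pd j f) x = pd j (pd i f) x := by
  rw [pd_pd i j hf, pd_pd j i hf]
  exact (hf.contDiffAt.isSymmSndFDerivAt minSmoothness_two_le).eq _ _

lemma laplacian_eq_sum_pd (hf : ContDiff ℝ ∞ f) :
    Laplacian.laplacian f x = ∑ k, pd k (pd k f) x := by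
  rw [InnerProductSpace.laplacian_eq_iteratedFDeriv_orthonormalBasis f
    (EuclideanSpace.basisFun (Fin 3) ℝ)]
  refine Finset.sum_congr rfl fun k _ => ?_
  rw [pd_pd k k hf, iteratedFDeriv_two_apply]
  simp

end Space

/-! ### Calculus on the space-time slab -/

namespace SmoothOn

variable {T ν t : ℝ} {u : ℝ → E3 → E3} {f g : ℝ → E3 → ℝ} {x : E3}

lemma contDiffAt (hf : SmoothOn T f) (ht : t ∈ Ioo 0 T) (x : E3) :
    ContDiffAt ℝ ∞ (fun z : ℝ × E3 => f z.1 z.2) (t, x) :=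
  ContDiffOn.contDiffAt hf ((isOpen_slab T).mem_nhds (mem_slab ht x))

lemma differentiableAt (hf : SmoothOn T f) (ht : t ∈ Ioo 0 T) (x : E3) :
    DifferentiableAt ℝ (fun z : ℝ × E3 => f z.1 z.2) (t, x) :=
  (hf.contDiffAt ht x).differentiableAt (by simp)

lemma slice (hf : SmoothOn T f) (ht : t ∈ Ioo 0 T) : ContDiff ℝ ∞ (f t) :=
  contDiff_iff_contDiffAt.2 fun x =>
    (hf.contDiffAt ht x).comp x (contDiffAt_const.prodMk contDiffAt_id)

lemma slice_diff (hf : SmoothOn T f) (ht : t ∈ Ioo 0 T) (x : E3) : DifferentiableAt ℝ (f t) x :=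
  (hf.slice ht).differentiable (by simp) x

lemma time_diff (hf : SmoothOn T f) (ht : t ∈ Ioo 0 T) (x : E3) :
    DifferentiableAt ℝ (fun s => f s x) t :=
  DifferentiableAt.comp (f := fun s : ℝ => (s, x)) t (hf.differentiableAt ht x)
    (differentiableAt_id.prodMk (differentiableAt_const x))

lemma pd_eq (hf : SmoothOn T f) (ht : t ∈ Ioo 0 T) (x : E3) (i : Fin 3) :
    pd i (f t) x = fderiv ℝ (fun z : ℝ × E3 => f z.1 z.2) (t, x) (0, EuclideanSpace.single i 1) := by
  have h1 : HasFDerivAt (fun y : E3 => (t, y)) (ContinuousLinearMap.inr ℝ ℝ E3) x :=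
    hasFDerivAt_prodMk_right t x
  have h := (hf.differentiableAt ht x).hasFDerivAt.comp x h1
  have h2 : fderiv ℝ (f t) x = _ := h.fderiv
  rw [pd, h2]
  simp

lemma deriv_eq (hf : SmoothOn T f) (ht : t ∈ Ioo 0 T) (x : E3) :
    deriv (fun s => f s x) t = fderiv ℝ (fun z : ℝ × E3 => f z.1 z.2) (t, x) (1, 0) := by
  have h1 : HasFDerivAt (fun s : ℝ => (s, x)) (ContinuousLinearMap.inl ℝ ℝ E3) t :=
    hasFDerivAt_prodMk_left t x
  have h := (hf.differentiableAt ht x).hasFDerivAt.comp t h1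
  have h2 : deriv (fun s => f s x) t = _ := h.hasDerivAt.deriv
  rw [h2]
  simp

lemma fderiv_apply (hf : SmoothOn T f) (w : ℝ × E3) :
    ContDiffOn ℝ ∞ (fun z => fderiv ℝ (fun z : ℝ × E3 => f z.1 z.2) z w) (Ioo 0 T ×ˢ univ) :=
  (ContDiffOn.fderiv_of_isOpen hf (isOpen_slab T) (m := ∞) le_rfl).clm_apply contDiffOn_const

lemma pd (hf : SmoothOn T f) (i : Fin 3) : SmoothOn T (fun s => DiffusiveLagrangian.pd i (f s)) :=
  (hf.fderiv_apply (0, EuclideanSpace.single i 1)).congr fun z hz => hf.pd_eq hz.1 z.2 i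

lemma dt (hf : SmoothOn T f) : SmoothOn T (fun s y => deriv (fun r => f r y) s) :=
  (hf.fderiv_apply (1, 0)).congr fun z hz => hf.deriv_eq hz.1 z.2

lemma add (hf : SmoothOn T f) (hg : SmoothOn T g) : SmoothOn T (fun s y => f s y + g s y) :=
  ContDiffOn.add hf hg

lemma sub (hf : SmoothOn T f) (hg : SmoothOn T g) : SmoothOn T (fun s y => f s y - g s y) :=
  ContDiffOn.sub hf hg

lemma mul (hf : SmoothOn T f) (hg : SmoothOn T g) : SmoothOn T (fun s y => f s y * g s y) :=
  ContDiffOn.mul hf hg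

lemma sum {ι : Type*} [Fintype ι] {F : ι → ℝ → E3 → ℝ} (hF : ∀ k, SmoothOn T (F k)) :
    SmoothOn T (fun s y => ∑ k, F k s y) :=
  ContDiffOn.sum fun k _ => hF k

/-- Both sides are mixed second derivatives of the space-time function, in the directions `(1, 0)`
and `(0, e_i)`, so symmetry of the second derivative applies. -/
lemma deriv_pd (hf : SmoothOn T f) (ht : t ∈ Ioo 0 T) (x : E3) (i : Fin 3) :
    deriv (fun s => DiffusiveLagrangian.pd i (f s) x) t =
      DiffusiveLagrangian.pd i (fun y => deriv (fun r => f r y) t) x := by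
  rw [(hf.pd i).deriv_eq ht x, hf.dt.pd_eq ht x i]
  have hn := (isOpen_slab T).mem_nhds (mem_slab ht x)
  have e1 : (fun z : ℝ × E3 => DiffusiveLagrangian.pd i (f z.1) z.2) =ᶠ[𝓝 (t, x)]
      fun z => fderiv ℝ (fun z : ℝ × E3 => f z.1 z.2) z (0, EuclideanSpace.single i 1) :=
    Filter.mem_of_superset hn fun z hz => hf.pd_eq hz.1 z.2 i
  have e2 : (fun z : ℝ × E3 => deriv (fun r => f r z.2) z.1) =ᶠ[𝓝 (t, x)]
      fun z => fderiv ℝ (fun z : ℝ × E3 => f z.1 z.2) z (1, 0) :=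
    Filter.mem_of_superset hn fun z hz => hf.deriv_eq hz.1 z.2
  have hd : DifferentiableAt ℝ (fderiv ℝ (fun z : ℝ × E3 => f z.1 z.2)) (t, x) :=
    ((hf.contDiffAt ht x).fderiv_right (m := ∞) le_rfl).differentiableAt (by simp)
  rw [e1.fderiv_eq, e2.fderiv_eq, fderiv_clm_apply hd (differentiableAt_const _),
    fderiv_clm_apply hd (differentiableAt_const _)]
  simpa using ((hf.contDiffAt ht x).isSymmSndFDerivAt minSmoothness_two_le).eq _ _

lemma Gam_eq (hf : SmoothOn T f) (ht : t ∈ Ioo 0 T) (x : E3) :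
    Gam ν u f t x = deriv (fun s => f s x) t + ∑ k, u t x k * DiffusiveLagrangian.pd k (f t) x -
      ν * ∑ k, DiffusiveLagrangian.pd k (DiffusiveLagrangian.pd k (f t)) x := by
  rw [Gam, laplacian_eq_sum_pd (hf.slice ht)]

lemma Gam_add (hf : SmoothOn T f) (hg : SmoothOn T g) (ht : t ∈ Ioo 0 T) (x : E3) :
    Gam ν u (fun s y => f s y + g s y) t x = Gam ν u f t x + Gam ν u g t x := by
  have h1 (i) : DiffusiveLagrangian.pd i (fun y => f t y + g t y) =
      fun y => DiffusiveLagrangian.pd i (f t) y + DiffusiveLagrangian.pd i (g t) y :=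
    funext fun y => pd_add i (hf.slice_diff ht y) (hg.slice_diff ht y)
  have h2 (i) := pd_add i ((hf.pd i).slice_diff ht x) ((hg.pd i).slice_diff ht x)
  rw [(hf.add hg).Gam_eq ht, hf.Gam_eq ht, hg.Gam_eq ht,
    deriv_fun_add (hf.time_diff ht x) (hg.time_diff ht x)]
  simp only [h1, h2, mul_add, Finset.sum_add_distrib]
  ring

lemma Gam_const_mul (hf : SmoothOn T f) (c : ℝ) (ht : t ∈ Ioo 0 T) (x : E3) :
    Gam ν u (fun s y => c * f s y) t x = c * Gam ν u f t x := by
  have h1 (i) : DiffusiveLagrangian.pd i (fun y => c * f t y) =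
      fun y => c * DiffusiveLagrangian.pd i (f t) y :=
    funext fun y => pd_const_mul i c (hf.slice_diff ht y)
  have h2 (i) := pd_const_mul i c ((hf.pd i).slice_diff ht x)
  have hc : SmoothOn T (fun s y => c * f s y) := ContDiffOn.mul contDiffOn_const hf
  rw [hc.Gam_eq ht, hf.Gam_eq ht, deriv_const_mul _ (hf.time_diff ht x)]
  simp only [h1, h2, Fin.sum_univ_three]
  ring

lemma Gam_sub (hf : SmoothOn T f) (hg : SmoothOn T g) (ht : t ∈ Ioo 0 T) (x : E3) :
    Gam ν u (fun s y => f s y - g s y) t x = Gam ν u f t x - Gam ν u g t x := by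
  have hc : SmoothOn T (fun s y => -1 * g s y) := ContDiffOn.mul contDiffOn_const hg
  have h := Gam_add (ν := ν) (u := u) hf hc ht x
  rw [Gam_const_mul hg _ ht] at h
  simpa [sub_eq_add_neg] using h

/-- The cross term comes from the Laplacian. It is what the source in the equation for `v` is
designed to cancel, and for `f = g` it is the dissipation. -/
lemma Gam_mul (hf : SmoothOn T f) (hg : SmoothOn T g) (ht : t ∈ Ioo 0 T) (x : E3) :
    Gam ν u (fun s y => f s y * g s y) t x = Gam ν u f t x * g t x + f t x * Gam ν u g t x -
      2 * ν * ∑ k, DiffusiveLagrangian.pd k (f t) x * DiffusiveLagrangian.pd k (g t) x := by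
  have h1 (i) : DiffusiveLagrangian.pd i (fun y => f t y * g t y) =
      fun y => DiffusiveLagrangian.pd i (f t) y * g t y + f t y * DiffusiveLagrangian.pd i (g t) y :=
    funext fun y => pd_mul i (hf.slice_diff ht y) (hg.slice_diff ht y)
  have h2 (i) := pd_add i (((hf.pd i).mul hg).slice_diff ht x) ((hf.mul (hg.pd i)).slice_diff ht x)
  have h3 (i) := pd_mul i ((hf.pd i).slice_diff ht x) (hg.slice_diff ht x)
  have h4 (i) := pd_mul i (hf.slice_diff ht x) ((hg.pd i).slice_diff ht x)
  rw [(hf.mul hg).Gam_eq ht, hf.Gam_eq ht, hg.Gam_eq ht,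
    deriv_fun_mul (hf.time_diff ht x) (hg.time_diff ht x)]
  simp only [h1, h2, h3, h4, Fin.sum_univ_three]
  ring

lemma Gam_sum {F : Fin 3 → ℝ → E3 → ℝ} (hF : ∀ k, SmoothOn T (F k)) (ht : t ∈ Ioo 0 T) (x : E3) :
    Gam ν u (fun s y => ∑ k, F k s y) t x = ∑ k, Gam ν u (F k) t x := by
  simp only [Fin.sum_univ_three]
  rw [Gam_add ((hF 0).add (hF 1)) (hF 2) ht, Gam_add (hF 0) (hF 1) ht]

/-- The commutator of `Γ` with a spatial derivative. -/
lemma Gam_pd (hf : SmoothOn T f) (hu : ∀ k, SmoothOn T (fun s y => u s y k)) (ht : t ∈ Ioo 0 T)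
    (x : E3) (i : Fin 3) :
    Gam ν u (fun s => DiffusiveLagrangian.pd i (f s)) t x =
      DiffusiveLagrangian.pd i (Gam ν u f t) x -
      ∑ k, DiffusiveLagrangian.pd i (fun y => u t y k) x * DiffusiveLagrangian.pd k (f t) x := by
  have e : Gam ν u f t = fun y => deriv (fun s => f s y) t +
      ∑ k, u t y k * DiffusiveLagrangian.pd k (f t) y -
      ν * ∑ k, DiffusiveLagrangian.pd k (DiffusiveLagrangian.pd k (f t)) y :=
    funext fun y => hf.Gam_eq ht y
  have s1 : ∀ k, SmoothOn T (fun s y => u s y k * DiffusiveLagrangian.pd k (f s) y) :=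
    fun k => (hu k).mul (hf.pd k)
  have s2 : ∀ k, SmoothOn T (fun s => DiffusiveLagrangian.pd k (DiffusiveLagrangian.pd k (f s))) :=
    fun k => (hf.pd k).pd k
  have hc (k) : DiffusiveLagrangian.pd k (DiffusiveLagrangian.pd i (f t)) =
      DiffusiveLagrangian.pd i (DiffusiveLagrangian.pd k (f t)) :=
    funext fun y => pd_comm k i (hf.slice ht)
  have hc' (k) : DiffusiveLagrangian.pd k (DiffusiveLagrangian.pd i (DiffusiveLagrangian.pd k (f t))) x =
      DiffusiveLagrangian.pd i (DiffusiveLagrangian.pd k (DiffusiveLagrangian.pd k (f t))) x :=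
    pd_comm k i ((hf.pd k).slice ht)
  rw [(hf.pd i).Gam_eq ht, e, hf.deriv_pd ht,
    pd_sub i ((hf.dt.add (sum s1)).slice_diff ht x) (((sum s2).slice_diff ht x).const_mul ν),
    pd_add i (hf.dt.slice_diff ht x) ((sum s1).slice_diff ht x),
    pd_const_mul i ν ((sum s2).slice_diff ht x),
    pd_sum i (fun k => (s1 k).slice_diff ht x), pd_sum i (fun k => (s2 k).slice_diff ht x)]
  simp only [pd_mul i ((hu _).slice_diff ht x) ((hf.pd _).slice_diff ht x), hc, hc',
    Finset.sum_add_distrib]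
  ring

end SmoothOn

/-! ### The parabolic maximum principle -/

lemma deriv_line {f : E3 → ℝ} (hf : Differentiable ℝ f) (x e : E3) (s : ℝ) :
    deriv (fun r : ℝ => f (x + r • e)) s = fderiv ℝ f (x + s • e) e := by
  have h1 : HasDerivAt (fun r : ℝ => x + r • e) e s := by
    simpa using ((hasDerivAt_id s).smul_const e).const_add x
  exact ((hf _).hasFDerivAt.comp_hasDerivAt s h1).deriv

lemma pd_eq_zero_of_max {f : E3 → ℝ} {x : E3} (hmax : ∀ y, f y ≤ f x) (k : Fin 3) :
    pd k f x = 0 := by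
  have h : IsLocalMax f x := Filter.Eventually.of_forall hmax
  simp [pd, h.fderiv_eq_zero]

/-- On the line through `x`, a positive second derivative would make the maximum also a local
minimum; the function would be locally constant there, with zero second derivative. -/
lemma pd_pd_nonpos_of_max {f : E3 → ℝ} (hf : ContDiff ℝ ∞ f) {x : E3} (hmax : ∀ y, f y ≤ f x)
    (k : Fin 3) : pd k (pd k f) x ≤ 0 := by
  set e : E3 := EuclideanSpace.single k 1
  set g : ℝ → ℝ := fun r => f (x + r • e) with hg
  have hd : Differentiable ℝ f := hf.differentiable (by simp)
  have h1 : deriv g = fun s => pd k f (x + s • e) := funext fun s => deriv_line hd x e s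
  have h2 : deriv (deriv g) 0 = pd k (pd k f) x := by
    rw [h1, deriv_line ((contDiff_pd k hf).differentiable (by simp)) x e 0]
    simp [pd, e]
  by_contra! hpos
  rw [← h2] at hpos
  have hmaxg : ∀ s, g s ≤ g 0 := fun s => by simpa [hg] using hmax (x + s • e)
  have h0 : deriv g 0 = 0 := by
    rw [h1]; simpa using pd_eq_zero_of_max hmax k
  have hcg : Continuous g := hd.continuous.comp (by fun_prop)
  have hmin := isLocalMin_of_deriv_deriv_pos hpos h0 hcg.continuousAt
  have hconst : g =ᶠ[𝓝 0] fun _ => g 0 := by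
    filter_upwards [hmin] with s hs using le_antisymm (hmaxg s) hs
  have : deriv (deriv g) 0 = 0 := by
    rw [hconst.deriv.deriv_eq]; simp
  linarith

/-- Only left difference quotients enter, since the maximum may sit at the final time. -/
lemma deriv_nonneg_of_left_max {g : ℝ → ℝ} {t : ℝ} (ht : 0 < t) (hg : DifferentiableAt ℝ g t)
    (hmax : ∀ s ∈ Icc 0 t, g s ≤ g t) : 0 ≤ deriv g t := by
  have h := hg.hasDerivAt.tendsto_slope.mono_left
    (nhdsWithin_mono t (fun s (hs : s ∈ Iio t) => ne_of_lt hs))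
  refine ge_of_tendsto h ?_
  filter_upwards [Ioo_mem_nhdsLT ht] with s hs
  rw [slope_def_field]
  exact div_nonneg_of_nonpos (by linarith [hmax s ⟨hs.1.le, hs.2.le⟩]) (by linarith [hs.2])

lemma pd_coord (i k : Fin 3) (x : E3) : pd i (fun y => y k) x = if k = i then 1 else 0 := by
  have h : HasFDerivAt (fun y : E3 => y k) (EuclideanSpace.proj k : E3 →L[ℝ] ℝ) x :=
    (EuclideanSpace.proj k : E3 →L[ℝ] ℝ).hasFDerivAt
  rw [pd, h.fderiv]
  simp

lemma norm_sq_eq_sum (x : E3) : ‖x‖ ^ 2 = ∑ k, x k * x k := by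
  rw [EuclideanSpace.norm_sq_eq]
  simp [sq]

lemma differentiable_coord (k : Fin 3) : Differentiable ℝ (fun y : E3 => y k) :=
  (EuclideanSpace.proj k : E3 →L[ℝ] ℝ).differentiable

lemma contDiff_coord (k : Fin 3) : ContDiff ℝ ∞ (fun y : E3 => y k) :=
  (EuclideanSpace.proj k : E3 →L[ℝ] ℝ).contDiff

section Barrier

variable {T ν t : ℝ} {u : ℝ → E3 → E3} {x : E3}

lemma smoothOn_quadratic : SmoothOn T (fun _ y => 1 + ∑ k, y k * y k) := by
  have h : ContDiff ℝ ∞ (fun y : E3 => 1 + ∑ k, y k * y k) :=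
    contDiff_const.add (ContDiff.sum fun k _ => (contDiff_coord k).mul (contDiff_coord k))
  exact (h.comp contDiff_snd).contDiffOn

lemma pd_quadratic (i : Fin 3) : pd i (fun y => 1 + ∑ k, y k * y k) = fun y => 2 * y i := by
  funext y
  have hd (k) : DifferentiableAt ℝ (fun y : E3 => y k * y k) y :=
    (differentiable_coord k y).mul (differentiable_coord k y)
  rw [pd_add i (differentiableAt_const _) (DifferentiableAt.fun_sum fun k _ => hd k),
    pd_sum i hd]
  simp only [pd_mul i (differentiable_coord _ y) (differentiable_coord _ y), pd_coord]
  simp [pd, Finset.sum_add_distrib]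
  ring

lemma Gam_quadratic (ht : t ∈ Ioo 0 T) :
    Gam ν u (fun _ y => 1 + ∑ k, y k * y k) t x = 2 * ∑ k, u t x k * x k - 6 * ν := by
  rw [smoothOn_quadratic.Gam_eq ht]
  simp only [pd_quadratic, pd_const_mul _ 2 (differentiable_coord _ x), pd_coord]
  simp [Fin.sum_univ_three]
  ring

lemma smoothOn_time {φ : ℝ → ℝ} (hφ : ContDiff ℝ ∞ φ) : SmoothOn T (fun s _ => φ s) :=
  (hφ.comp contDiff_fst).contDiffOn

lemma Gam_time {φ : ℝ → ℝ} (hφ : ContDiff ℝ ∞ φ) (ht : t ∈ Ioo 0 T) :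
    Gam ν u (fun s _ => φ s) t x = deriv φ t := by
  have h (c : ℝ) (k : Fin 3) : pd k (fun _ => c) = fun _ => 0 := by
    funext y
    simp [pd]
  rw [(smoothOn_time hφ).Gam_eq ht]
  simp [h]

end Barrier

/-- Bounded subsolutions of `Γ h ≤ C h` that are initially nonpositive remain nonpositive,
provided that the drift does not push inwards faster than linearly. -/
theorem nonpos_of_subsolution {T T' ν C D M : ℝ} {u : ℝ → E3 → E3} {h : ℝ → E3 → ℝ}
    (hT : T' < T) (hν : 0 ≤ ν) (hs : SmoothOn T h)
    (hc : ContinuousOn (fun z : ℝ × E3 => h z.1 z.2) (Icc 0 T' ×ˢ univ))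
    (hM : ∀ t ∈ Icc 0 T', ∀ x, h t x ≤ M) (h0 : ∀ x, h 0 x ≤ 0)
    (hu : ∀ t ∈ Icc 0 T', ∀ x, -(2 * ∑ k, u t x k * x k) + 6 * ν ≤ D * (1 + ∑ k, x k * x k))
    (hG : ∀ t ∈ Ioc 0 T', ∀ x, Gam ν u h t x ≤ C * h t x) :
    ∀ t ∈ Icc 0 T', ∀ x, h t x ≤ 0 := by
  intro t₀ ht₀ x₀
  by_contra! hpos
  set N : E3 → ℝ := fun y => 1 + ∑ k, y k * y k with hN
  have hN' (x : E3) : N x = 1 + ‖x‖ ^ 2 := by rw [hN, norm_sq_eq_sum]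
  have hN1 (x : E3) : 1 ≤ N x := by rw [hN']; nlinarith [norm_nonneg x]
  -- The decay rate exceeds by one what is needed to absorb both the growth rate `C` and the drift
  -- acting on the barrier `ε N`.
  set l : ℝ := |C| + |D| + 1
  set φ : ℝ → ℝ := fun s => Real.exp (-l * s) with hφ
  have hφs : ContDiff ℝ ∞ φ := by rw [hφ]; fun_prop
  have hφpos (s) : 0 < φ s := Real.exp_pos _
  have hφ1 (s) (hs : 0 ≤ s) : φ s ≤ 1 :=
    Real.exp_le_one_iff.2 (by have : 0 ≤ l := by positivity
                              nlinarith)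
  have hφd (s) : deriv φ s = -l * φ s := by
    have : HasDerivAt φ (Real.exp (-l * s) * (-l * 1)) s :=
      ((hasDerivAt_id s).const_mul (-l)).exp
    rw [this.deriv]; ring
  -- Half the value that would make `ψ` vanish at `(t₀, x₀)`, so `ψ` stays positive there.
  set ε : ℝ := φ t₀ * h t₀ x₀ / (2 * N x₀)
  have hN0 : 0 < N x₀ := by linarith [hN1 x₀]
  have hε : 0 < ε := div_pos (mul_pos (hφpos _) hpos) (by linarith)
  set ψ : ℝ → E3 → ℝ := fun s y => φ s * h s y - ε * N y with hψ
  have hψ₀ : 0 < ψ t₀ x₀ := by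
    have : ε * N x₀ = φ t₀ * h t₀ x₀ / 2 := by
      simp only [ε]; field_simp
    have h2 := mul_pos (hφpos t₀) hpos
    simp only [hψ, this]; linarith
  -- Beyond this radius the barrier dominates `M`; the `+ 1` ensures `R ≥ 1`, so that `‖x‖² ≥ ‖x‖`
  -- there.
  set R : ℝ := max M 0 / ε + 1
  have hR1 : 1 ≤ R := le_add_of_nonneg_left (by positivity)
  have hfar : ∀ t ∈ Icc 0 T', ∀ x, R < ‖x‖ → ψ t x ≤ 0 := by
    intro t ht x hx
    have e1 : φ t * h t x ≤ max M 0 := by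
      rcases le_or_gt (h t x) 0 with hh | hh
      · exact (mul_nonpos_of_nonneg_of_nonpos (hφpos t).le hh).trans (le_max_right _ _)
      · calc φ t * h t x ≤ 1 * h t x := by gcongr; exact hφ1 t ht.1
          _ ≤ M := by simpa using hM t ht x
          _ ≤ _ := le_max_left _ _
    have e2 : max M 0 ≤ ε * N x := by
      have : max M 0 / ε ≤ N x := by
        have : max M 0 / ε = R - 1 := by simp [R]
        rw [hN', this]; nlinarith
      rwa [div_le_iff₀' hε] at this
    simp only [hψ]; linarith
  -- `N` does not depend on time, so the values 2 and 1 are arbitrary.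
  have hNc : Continuous N := (smoothOn_quadratic (T := 2)).slice (t := 1) (by norm_num) |>.continuous
  have hψc : ContinuousOn (fun z : ℝ × E3 => ψ z.1 z.2) (Icc 0 T' ×ˢ univ) :=
    ((hφs.continuous.comp continuous_fst).continuousOn.mul hc).sub
      (continuous_const.mul (hNc.comp continuous_snd)).continuousOn
  have hx₀ : x₀ ∈ Metric.closedBall (0 : E3) R := by
    by_contra hx
    have := hfar t₀ ht₀ x₀ (by simpa using hx)
    linarith
  obtain ⟨⟨t₁, x₁⟩, ⟨ht₁, -⟩, hmax⟩ :=
    (isCompact_Icc.prod (isCompact_closedBall (0 : E3) R)).exists_isMaxOn ⟨(t₀, x₀), ht₀, hx₀⟩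
      (hψc.mono (prod_mono_right (subset_univ _)))
  have hψ₁ : 0 < ψ t₁ x₁ := hψ₀.trans_le (hmax (show (t₀, x₀) ∈ _ from ⟨ht₀, hx₀⟩))
  replace hmax : ∀ t ∈ Icc 0 T', ∀ x, ψ t x ≤ ψ t₁ x₁ := by
    intro t ht x
    by_cases hx : R < ‖x‖
    · exact (hfar t ht x hx).trans hψ₁.le
    · exact hmax (show (t, x) ∈ _ from ⟨ht, by simpa using hx⟩)
  simp only at ht₁
  have ht₁0 : 0 < t₁ := by
    refine lt_of_le_of_ne ht₁.1 fun h1 => ?_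
    rw [← h1] at hψ₁
    have e1 := mul_nonpos_of_nonneg_of_nonpos (hφpos 0).le (h0 x₁)
    have e2 : 0 < ε * N x₁ := mul_pos hε (by linarith [hN1 x₁])
    simp only [hψ] at hψ₁; linarith
  have ht₁T : t₁ ∈ Ioo 0 T := ⟨ht₁0, ht₁.2.trans_lt hT⟩
  have hsφ : SmoothOn T (fun s _ => φ s) := smoothOn_time hφs
  have hsN : SmoothOn T (fun _ => N) := smoothOn_quadratic
  have hsε : SmoothOn T (fun _ y => ε * N y) := contDiffOn_const.mul hsN
  have hsψ : SmoothOn T ψ := (hsφ.mul hs).sub hsε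
  have hge : 0 ≤ Gam ν u ψ t₁ x₁ := by
    have hm := hmax t₁ ht₁
    have d1 := deriv_nonneg_of_left_max ht₁0 (hsψ.time_diff ht₁T x₁)
      (fun s hs => hmax s ⟨hs.1, hs.2.trans ht₁.2⟩ x₁)
    have d2 : ∑ k, pd k (pd k (ψ t₁)) x₁ ≤ 0 :=
      Finset.sum_nonpos fun k _ => pd_pd_nonpos_of_max (hsψ.slice ht₁T) hm k
    rw [hsψ.Gam_eq ht₁T]
    simp only [pd_eq_zero_of_max hm, mul_zero, Finset.sum_const_zero]
    nlinarith [mul_nonpos_of_nonneg_of_nonpos hν d2]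
  have hGψ : Gam ν u ψ t₁ x₁ = -l * φ t₁ * h t₁ x₁ + φ t₁ * Gam ν u h t₁ x₁ -
      ε * (2 * ∑ k, u t₁ x₁ k * x₁ k - 6 * ν) := by
    rw [hψ, (hsφ.mul hs).Gam_sub hsε ht₁T, hsφ.Gam_mul hs ht₁T, hsN.Gam_const_mul ε ht₁T,
      Gam_time hφs ht₁T, Gam_quadratic ht₁T, hφd]
    simp [pd]
  -- At the maximum `ε N < φ h`, so these bounds give `Γ ψ ≤ (|C| + |D| - l) φ h = -φ h < 0`,
  -- against `hge`.
  have i1 := mul_le_mul_of_nonneg_left (hG t₁ ⟨ht₁0, ht₁.2⟩ x₁) (hφpos t₁).le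
  have i2 := mul_le_mul_of_nonneg_left (hu t₁ ht₁ x₁) hε.le
  have i3 : ε * N x₁ < φ t₁ * h t₁ x₁ := by simp only [hψ] at hψ₁; linarith
  have i4 : 0 < ε * N x₁ := mul_pos hε (by linarith [hN1 x₁])
  have i5 : D * (ε * N x₁) ≤ |D| * (φ t₁ * h t₁ x₁) :=
    mul_le_mul (le_abs_self D) i3.le i4.le (abs_nonneg D)
  have i6 : C * (φ t₁ * h t₁ x₁) ≤ |C| * (φ t₁ * h t₁ x₁) :=
    mul_le_mul_of_nonneg_right (le_abs_self C) (i4.trans i3).le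
  have i7 : l * (φ t₁ * h t₁ x₁) = |C| * (φ t₁ * h t₁ x₁) + |D| * (φ t₁ * h t₁ x₁) +
    φ t₁ * h t₁ x₁ := by simp only [l]; ring
  change ε * _ ≤ ε * (D * N x₁) at i2
  nlinarith

/-! ### Classical fields -/

namespace ClassicalField

variable {T t : ℝ} {f : ℝ → E3 → E3}

lemma smoothOn (hf : ClassicalField T f) (i : Fin 3) : SmoothOn T (fun s y => f s y i) :=
  (EuclideanSpace.proj i : E3 →L[ℝ] ℝ).contDiff.comp_contDiffOn hf.smooth

lemma pd_eq (hf : ClassicalField T f) (ht : t ∈ Ico 0 T) (x : E3) (i j : Fin 3) :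
    pd i (fun y => f t y j) x = fderiv ℝ (f t) x (EuclideanSpace.single i 1) j := by
  have h := (EuclideanSpace.proj j : E3 →L[ℝ] ℝ).hasFDerivAt.comp x (hf.diff t ht x).hasFDerivAt
  have h2 : fderiv ℝ (fun y => f t y j) x = _ := h.fderiv
  rw [pd, h2]
  simp

lemma continuousOn_pd (hf : ClassicalField T f) (i j : Fin 3) :
    ContinuousOn (fun z : ℝ × E3 => pd i (fun y => f z.1 y j) z.2) (Ico 0 T ×ˢ univ) := by
  have h : ContinuousOn (fun z : ℝ × E3 => fderiv ℝ (f z.1) z.2 (EuclideanSpace.single i 1) j)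
      (Ico 0 T ×ˢ univ) :=
    (EuclideanSpace.proj j : E3 →L[ℝ] ℝ).continuous.comp_continuousOn
      (hf.cont_grad.clm_apply continuousOn_const)
  exact h.congr fun z hz => hf.pd_eq hz.1 z.2 i j

lemma exists_abs_pd_le (hf : ClassicalField T f) {T' : ℝ} (hT : T' < T) :
    ∃ K : ℝ, 0 ≤ K ∧ ∀ t ∈ Icc 0 T', ∀ x, ∀ i j, |pd i (fun y => f t y j) x| ≤ K := by
  obtain ⟨K, hK⟩ := hf.bdd_grad T' hT
  refine ⟨max K 0, le_max_right _ _, fun t ht x i j => ?_⟩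
  rw [hf.pd_eq ⟨ht.1, ht.2.trans_lt hT⟩, ← Real.norm_eq_abs]
  calc _ ≤ ‖fderiv ℝ (f t) x (EuclideanSpace.single i 1)‖ := PiLp.norm_apply_le _ _
    _ ≤ ‖fderiv ℝ (f t) x‖ * ‖(EuclideanSpace.single i 1 : E3)‖ := ContinuousLinearMap.le_opNorm _ _
    _ ≤ max K 0 := by simpa using Or.inl (hK t ht x)

lemma exists_drift_bound (hf : ClassicalField T f) {T' ν : ℝ} (hν : 0 ≤ ν) (hT : T' < T) :
    ∃ D : ℝ, ∀ t ∈ Icc 0 T', ∀ x,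
      -(2 * ∑ k, f t x k * x k) + 6 * ν ≤ D * (1 + ∑ k, x k * x k) := by
  obtain ⟨K, hK⟩ := hf.bdd_grad T' hT
  have hc : ContinuousOn (fun t => f t 0) (Icc 0 T') :=
    hf.cont.comp (f := fun t : ℝ => (t, (0 : E3))) (by fun_prop)
      fun t ht => ⟨⟨ht.1, ht.2.trans_lt hT⟩, mem_univ _⟩
  obtain ⟨B, hB⟩ := isCompact_Icc.exists_bound_of_continuousOn hc
  -- From `‖f‖ ≤ B + K ‖x‖` one gets `-2 f·x ≤ 2 B ‖x‖ + 2 K ‖x‖²`, and `2 ‖x‖ ≤ 1 + ‖x‖²`.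
  refine ⟨B + 2 * K + 6 * ν, fun t ht x => ?_⟩
  have h1 : ‖f t x - f t 0‖ ≤ K * ‖x - 0‖ :=
    convex_univ.norm_image_sub_le_of_norm_fderiv_le (𝕜 := ℝ)
      (fun y _ => hf.diff t ⟨ht.1, ht.2.trans_lt hT⟩ y) (fun y _ => hK t ht y)
      (mem_univ _) (mem_univ _)
  have h2 : ‖f t x‖ ≤ B + K * ‖x‖ := by
    have := norm_sub_norm_le (f t x) (f t 0)
    rw [sub_zero] at h1
    linarith [hB t ht]
  have h3 : -∑ k, f t x k * x k ≤ ‖f t x‖ * ‖x‖ := by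
    have h := neg_le_of_abs_le (abs_real_inner_le_norm (f t x) x)
    have e : inner ℝ (f t x) x = ∑ k, f t x k * x k := by
      simp [PiLp.inner_apply, mul_comm]
    rw [e] at h
    linarith
  have hB0 : 0 ≤ B := (norm_nonneg _).trans (hB t ht)
  have hK0 : 0 ≤ K := (norm_nonneg _).trans (hK t ht x)
  rw [← norm_sq_eq_sum]
  nlinarith [mul_le_mul_of_nonneg_right h2 (norm_nonneg x), mul_nonneg hB0 (sq_nonneg (‖x‖ - 1)),
    mul_nonneg hν (sq_nonneg ‖x‖), sq_nonneg ‖x‖]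

end ClassicalField

/-! ### Evolution equations -/

section Evolution

variable {T ν t : ℝ} {u A v : ℝ → E3 → E3} {p : ℝ → E3 → ℝ}

lemma Gam_congr {f g : ℝ → E3 → ℝ} (h : ∀ s ∈ Ioo 0 T, ∀ y, f s y = g s y) (ht : t ∈ Ioo 0 T)
    (x : E3) : Gam ν u f t x = Gam ν u g t x := by
  have e1 : f t = g t := funext (h t ht)
  have e2 : (fun s => f s x) =ᶠ[𝓝 t] fun s => g s x :=
    Filter.mem_of_superset (isOpen_Ioo.mem_nhds ht) fun s hs => h s hs x
  rw [Gam, Gam, e1, e2.deriv_eq]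

/-- The chain rule through the label map: `Q ∇A = 1` recovers Eulerian derivatives from label
derivatives. -/
lemma sum_labelPd_mul_pd {F : E3 → E3} {x : E3} (hF : IsUnit (gradMat F x)) (f : E3 → ℝ)
    (j : Fin 3) : ∑ m, labelPd F m f x * pd j (fun y => F y m) x = pd j f x := by
  have h : (gradMat F x)⁻¹ * gradMat F x = 1 :=
    Matrix.nonsing_inv_mul _ ((Matrix.isUnit_iff_isUnit_det _).1 hF)
  have h' (l : Fin 3) : ∑ m, (gradMat F x)⁻¹ l m * pd j (fun y => F y m) x =
      if l = j then 1 else 0 := by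
    rw [← Matrix.one_apply, ← h, Matrix.mul_apply]
    rfl
  simp only [labelPd, Finset.sum_mul]
  rw [Finset.sum_comm]
  calc _ = ∑ l, (∑ m, (gradMat F x)⁻¹ l m * pd j (fun y => F y m) x) * pd l f x := by
        simp only [Finset.sum_mul]
        exact Finset.sum_congr rfl fun l _ => Finset.sum_congr rfl fun m _ => by ring
    _ = _ := by simp [h']

/-- The Weber covector `W_j = v_m ∂_j A^m`. -/
noncomputable def weber (A v : ℝ → E3 → E3) (j : Fin 3) (t : ℝ) (x : E3) : ℝ :=
  ∑ m, v t x m * pd j (fun y => A t y m) x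

lemma smoothOn_weber (hA : ClassicalField T A) (hv : ClassicalField T v) (j : Fin 3) :
    SmoothOn T (weber A v j) :=
  SmoothOn.sum fun m => (hv.smoothOn m).mul ((hA.smoothOn m).pd j)

lemma Gam_weber (hu : ClassicalField T u) (hA : DiffusiveLabel ν T u A)
    (hv : VirtualVelocity ν T u A v) (ht : t ∈ Ioo 0 T) (x : E3) (j : Fin 3) :
    Gam ν u (weber A v j) t x = -∑ k, pd j (fun y => u t y k) x * weber A v k t x := by
  have sA (m) := hA.field.smoothOn m
  have sv (m) := hv.field.smoothOn m
  have hA0 (m) : Gam ν u (fun s y => A s y m) t = fun _ => 0 := funext fun y => hA.eqn t ht y m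
  have hGA (m) : Gam ν u (fun s => pd j (fun y => A s y m)) t x =
      -∑ k, pd j (fun y => u t y k) x * pd k (fun y => A t y m) x := by
    have h := (sA m).Gam_pd (ν := ν) (fun k => hu.smoothOn k) ht x j
    rw [hA0] at h
    simpa [pd] using h
  have hcomm (m k) : pd k (pd j (fun y => A t y m)) x = pd j (pd k (fun y => A t y m)) x :=
    pd_comm k j ((sA m).slice ht)
  -- Contracting with `∂_j A^m` turns `∇^A_m` into `∂_j`, so the coefficients `C` become second
  -- derivatives of `A`, matching the cross term.
  have hsrc : ∑ m, (2 * ν * ∑ n, ∑ k, commCoeff (A t) n k m x * pd k (fun y => v t y n) x) *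
      pd j (fun y => A t y m) x =
      2 * ν * ∑ n, ∑ k, pd j (pd k (fun y => A t y n)) x * pd k (fun y => v t y n) x := by
    have h (n k) := sum_labelPd_mul_pd (hA.invertible t ⟨ht.1.le, ht.2⟩ x)
      (pd k (fun y => A t y n)) j
    simp only [← h, commCoeff, Fin.sum_univ_three]
    ring
  have hG (m) : Gam ν u (fun s y => v s y m * pd j (fun y => A s y m) y) t x = _ :=
    (sv m).Gam_mul ((sA m).pd j) ht x
  change Gam ν u (fun s y => ∑ m, v s y m * pd j (fun y => A s y m) y) t x = _
  rw [SmoothOn.Gam_sum (fun m => (sv m).mul ((sA m).pd j)) ht]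
  simp only [hG, hv.eqn t ht x, hGA, hcomm, Finset.sum_sub_distrib, Finset.sum_add_distrib, hsrc,
    weber]
  simp only [Fin.sum_univ_three]
  ring

/-- The equation for `w` is Lie transport of a 1-form with diffusion, and both operations commute
with the exterior derivative. The gradient and the terms in `∂_i ∂_j u_k` drop out by symmetry. -/
lemma Gam_exteriorDerivative (hu : ∀ k, SmoothOn T (fun s y => u s y k))
    {w : Fin 3 → ℝ → E3 → ℝ} (hw : ∀ j, SmoothOn T (w j)) {g : E3 → ℝ} (hg : ContDiff ℝ ∞ g)
    (ht : t ∈ Ioo 0 T)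
    (heq : ∀ j x, Gam ν u (w j) t x = -(∑ k, pd j (fun y => u t y k) x * w k t x) + pd j g x)
    (x : E3) (i j : Fin 3) :
    Gam ν u (fun s y => pd i (w j s) y - pd j (w i s) y) t x =
      -∑ k, (pd i (fun y => u t y k) x * (pd k (w j t) x - pd j (w k t) x) +
        pd j (fun y => u t y k) x * (pd i (w k t) x - pd k (w i t) x)) := by
  have e (j) : Gam ν u (w j) t =
      fun x => pd j g x - ∑ k, pd j (fun y => u t y k) x * w k t x :=
    funext fun x => by rw [heq]; ring
  have d1 (j k) : DifferentiableAt ℝ (pd j (fun y => u t y k)) x := ((hu k).pd j).slice_diff ht x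
  have d2 (k) : DifferentiableAt ℝ (w k t) x := (hw k).slice_diff ht x
  have d3 (j) : DifferentiableAt ℝ (pd j g) x := (contDiff_pd j hg).differentiable (by simp) x
  have hp (i j) : pd i (Gam ν u (w j) t) x = pd i (pd j g) x -
      ∑ k, (pd i (pd j (fun y => u t y k)) x * w k t x +
        pd j (fun y => u t y k) x * pd i (w k t) x) := by
    have d4 (k) : DifferentiableAt ℝ (fun x => pd j (fun y => u t y k) x * w k t x) x :=
      (d1 j k).mul (d2 k)
    rw [e, pd_sub i (d3 j) (DifferentiableAt.fun_sum fun k _ => d4 k), pd_sum i d4]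
    simp only [pd_mul i (d1 j _) (d2 _)]
  have c1 : pd i (pd j g) x = pd j (pd i g) x := pd_comm i j hg
  have c2 (k) : pd i (pd j (fun y => u t y k)) x = pd j (pd i (fun y => u t y k)) x :=
    pd_comm i j ((hu k).slice ht)
  rw [((hw j).pd i).Gam_sub ((hw i).pd j) ht, (hw j).Gam_pd hu ht, (hw i).Gam_pd hu ht, hp i j,
    hp j i, c1]
  simp only [c2, Fin.sum_univ_three]
  ring

/-- The deviation from the viscous Cauchy formula, as an antisymmetric matrix. -/
noncomputable def cauchyDefect (u A v : ℝ → E3 → E3) (i j : Fin 3) (t : ℝ) (x : E3) : ℝ :=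
  ∑ m, (pd i (fun y => v t y m) x * pd j (fun y => A t y m) x -
    pd j (fun y => v t y m) x * pd i (fun y => A t y m) x) -
  (pd i (fun y => u t y j) x - pd j (fun y => u t y i) x)

lemma smoothOn_cauchyDefect (hu : ClassicalField T u) (hA : ClassicalField T A)
    (hv : ClassicalField T v) (i j : Fin 3) : SmoothOn T (cauchyDefect u A v i j) :=
  (SmoothOn.sum fun m => (((hv.smoothOn m).pd i).mul ((hA.smoothOn m).pd j)).sub
    (((hv.smoothOn m).pd j).mul ((hA.smoothOn m).pd i))).sub
    (((hu.smoothOn j).pd i).sub ((hu.smoothOn i).pd j))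

lemma continuousOn_cauchyDefect (hu : ClassicalField T u) (hA : ClassicalField T A)
    (hv : ClassicalField T v) (i j : Fin 3) :
    ContinuousOn (fun z : ℝ × E3 => cauchyDefect u A v i j z.1 z.2) (Ico 0 T ×ˢ univ) :=
  (continuousOn_finsetSum _ fun m _ =>
    ((hv.continuousOn_pd i m).mul (hA.continuousOn_pd j m)).sub
      ((hv.continuousOn_pd j m).mul (hA.continuousOn_pd i m))).sub
    ((hu.continuousOn_pd i j).sub (hu.continuousOn_pd j i))

lemma exists_abs_cauchyDefect_le (hu : ClassicalField T u) (hA : ClassicalField T A)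
    (hv : ClassicalField T v) {T' : ℝ} (hT : T' < T) :
    ∃ M : ℝ, ∀ t ∈ Icc 0 T', ∀ x, ∀ i j, |cauchyDefect u A v i j t x| ≤ M := by
  obtain ⟨a, ha, hA'⟩ := hA.exists_abs_pd_le hT
  obtain ⟨b, hb, hv'⟩ := hv.exists_abs_pd_le hT
  obtain ⟨c, hc, hu'⟩ := hu.exists_abs_pd_le hT
  refine ⟨∑ _m : Fin 3, (b * a + b * a) + (c + c), fun t ht x i j => ?_⟩
  have hm (i j m) : |pd i (fun y => v t y m) x * pd j (fun y => A t y m) x| ≤ b * a := by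
    rw [abs_mul]
    exact mul_le_mul (hv' t ht x i m) (hA' t ht x j m) (abs_nonneg _) hb
  refine (abs_sub _ _).trans (add_le_add ((Finset.abs_sum_le_sum_abs _ _).trans
    (Finset.sum_le_sum fun m _ => ?_)) ?_)
  · exact (abs_sub _ _).trans (add_le_add (hm i j m) (hm j i m))
  · exact (abs_sub _ _).trans (add_le_add (hu' t ht x i j) (hu' t ht x j i))

/-- The second derivatives of `A` cancel by symmetry. This form is restricted to positive times,
where they exist; the definition, first order only, also makes sense at time zero. -/
lemma cauchyDefect_eq (hu : ClassicalField T u) (hA : ClassicalField T A)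
    (hv : ClassicalField T v) (ht : t ∈ Ioo 0 T) (x : E3) (i j : Fin 3) :
    cauchyDefect u A v i j t x = pd i (fun y => weber A v j t y - u t y j) x -
      pd j (fun y => weber A v i t y - u t y i) x := by
  have sA (m) := hA.smoothOn m
  have sv (m) := hv.smoothOn m
  have h (i j) : pd i (fun y => weber A v j t y - u t y j) x =
      ∑ m, (pd i (fun y => v t y m) x * pd j (fun y => A t y m) x +
        v t x m * pd i (pd j (fun y => A t y m)) x) - pd i (fun y => u t y j) x := by
    have e : weber A v j t = fun x => ∑ m, v t x m * pd j (fun y => A t y m) x := rfl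
    rw [pd_sub i ((smoothOn_weber hA hv j).slice_diff ht x) ((hu.smoothOn j).slice_diff ht x), e,
      pd_sum i fun m => ((sv m).mul ((sA m).pd j)).slice_diff ht x]
    simp only [pd_mul i ((sv _).slice_diff ht x) (((sA _).pd j).slice_diff ht x)]
  have c (m) : pd i (pd j (fun y => A t y m)) x = pd j (pd i (fun y => A t y m)) x :=
    pd_comm i j ((sA m).slice ht)
  rw [h, h, cauchyDefect]
  simp only [c, Fin.sum_univ_three]
  ring

lemma Gam_cauchyDefect (hu : NavierStokes ν T u p) (hA : DiffusiveLabel ν T u A)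
    (hv : VirtualVelocity ν T u A v) (ht : t ∈ Ioo 0 T) (x : E3) (i j : Fin 3) :
    Gam ν u (cauchyDefect u A v i j) t x =
      -∑ k, (pd i (fun y => u t y k) x * cauchyDefect u A v k j t x +
        pd j (fun y => u t y k) x * cauchyDefect u A v i k t x) := by
  have su (k) := hu.field.smoothOn k
  have sW (k) := smoothOn_weber hA.field hv.field k
  have hd (k) := (su k).slice_diff ht
  have hp : Differentiable ℝ (p t) := (hu.pressure t ht).differentiable (by simp)
  -- The potential is `p - |u|²/2` because `(∂_j u_k) u_k = ∂_j (|u|²/2)` when `W` is replaced by `W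
  -- - u` in the stretching term.
  have hg : ContDiff ℝ ∞ (fun y => p t y - 1 / 2 * ∑ k, u t y k * u t y k) :=
    (hu.pressure t ht).sub (contDiff_const.mul
      (ContDiff.sum fun k _ => ((su k).slice ht).mul ((su k).slice ht)))
  have hpg (j x) : pd j (fun y => p t y - 1 / 2 * ∑ k, u t y k * u t y k) x =
      pd j (p t) x - ∑ k, pd j (fun y => u t y k) x * u t x k := by
    have hs (k) : DifferentiableAt ℝ (fun y => u t y k * u t y k) x := (hd k x).mul (hd k x)
    rw [pd_sub j (hp x) ((DifferentiableAt.fun_sum fun k _ => hs k).const_mul _),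
      pd_const_mul j _ (DifferentiableAt.fun_sum fun k _ => hs k), pd_sum j hs]
    simp only [pd_mul j (hd _ x) (hd _ x), Fin.sum_univ_three]
    ring
  have h := Gam_exteriorDerivative (ν := ν) (u := u) (w := fun j s y => weber A v j s y - u s y j)
    su (fun j => (sW j).sub (su j)) hg ht (fun j x => ?_) x i j
  · rw [Gam_congr (fun s hs y => cauchyDefect_eq hu.field hA.field hv.field hs y i j) ht, h]
    simp only [cauchyDefect_eq hu.field hA.field hv.field ht]
  · have hm := hu.momentum t ht x j
    rw [(sW j).Gam_sub (su j) ht, Gam_weber hu.field hA hv ht, hpg]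
    simp only [mul_sub, Finset.sum_sub_distrib]
    linarith

lemma cauchyDefect_zero (hA0 : ∀ x, A 0 x = x) (hv0 : ∀ x, v 0 x = u 0 x) (x : E3)
    (i j : Fin 3) : cauchyDefect u A v i j 0 x = 0 := by
  simp only [cauchyDefect, hA0, hv0, pd_coord]
  simp [Finset.sum_sub_distrib]

lemma abs_mul_mul_le {a b c K : ℝ} (ha : |a| ≤ K) : -(b * (a * c)) ≤ K * ((b * b + c * c) / 2) := by
  have h1 : |b * c| ≤ (b * b + c * c) / 2 := by
    rw [abs_le]; constructor <;> nlinarith [sq_nonneg (b + c), sq_nonneg (b - c)]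
  calc -(b * (a * c)) ≤ |b * (a * c)| := neg_le_abs _
    _ = |a| * |b * c| := by rw [← abs_mul]; congr 1; ring
    _ ≤ _ := mul_le_mul ha h1 (abs_nonneg _) ((abs_nonneg _).trans ha)

theorem cauchyDefect_eq_zero (hν : 0 ≤ ν) (hu : NavierStokes ν T u p) (hA : DiffusiveLabel ν T u A)
    (hv : VirtualVelocity ν T u A v) (ht : t ∈ Ico 0 T) (x : E3) (i j : Fin 3) :
    cauchyDefect u A v i j t x = 0 := by
  set b := cauchyDefect u A v
  set h : ℝ → E3 → ℝ := fun s y => ∑ i, ∑ j, b i j s y * b i j s y with hh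
  have sb (i j) : SmoothOn T (b i j) := smoothOn_cauchyDefect hu.field hA.field hv.field i j
  have hT : (t + T) / 2 < T := by linarith [ht.2]
  obtain ⟨M, hM⟩ := exists_abs_cauchyDefect_le hu.field hA.field hv.field hT
  obtain ⟨K, hK0, hK⟩ := hu.field.exists_abs_pd_le hT
  obtain ⟨D, hD⟩ := hu.field.exists_drift_bound hν hT
  have hle : h t x ≤ 0 := by
    refine nonpos_of_subsolution (C := 12 * K) (M := ∑ _i : Fin 3, ∑ _j : Fin 3, M * M) hT hν
      (SmoothOn.sum fun i => SmoothOn.sum fun j => (sb i j).mul (sb i j)) ?_ ?_ ?_ hD ?_ t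
      ⟨ht.1, by linarith [ht.2]⟩ x
    · refine (continuousOn_finsetSum _ fun i _ => continuousOn_finsetSum _ fun j _ => ?_)
      have := (continuousOn_cauchyDefect hu.field hA.field hv.field i j).mono
        (prod_mono_left (fun s (hs : s ∈ Icc 0 ((t + T) / 2)) =>
          (⟨hs.1, hs.2.trans_lt hT⟩ : s ∈ Ico 0 T)))
      exact this.mul this
    · refine fun s hs y => Finset.sum_le_sum fun i _ => Finset.sum_le_sum fun j _ => ?_
      rw [← abs_mul_abs_self]
      exact mul_self_le_mul_self (abs_nonneg _) (hM s hs y i j)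
    · intro y
      have hb (i j) : b i j 0 y = 0 := cauchyDefect_zero hA.init hv.init y i j
      simp [hb]
    · intro s hs y
      have hsT : s ∈ Ioo 0 T := ⟨hs.1, hs.2.trans_lt hT⟩
      have e : Gam ν u h s y = ∑ i, ∑ j, (Gam ν u (b i j) s y * b i j s y +
          b i j s y * Gam ν u (b i j) s y -
          2 * ν * ∑ k, pd k (b i j s) y * pd k (b i j s) y) := by
        rw [hh, SmoothOn.Gam_sum (fun i => SmoothOn.sum fun j => (sb i j).mul (sb i j)) hsT]
        refine Finset.sum_congr rfl fun i _ => ?_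
        rw [SmoothOn.Gam_sum (fun j => (sb i j).mul (sb i j)) hsT]
        exact Finset.sum_congr rfl fun j _ => (sb i j).Gam_mul (sb i j) hsT y
      have hterm (i j) : Gam ν u (b i j) s y * b i j s y + b i j s y * Gam ν u (b i j) s y -
          2 * ν * ∑ k, pd k (b i j s) y * pd k (b i j s) y ≤
          2 * ∑ k, (K * ((b i j s y * b i j s y + b k j s y * b k j s y) / 2) +
            K * ((b i j s y * b i j s y + b i k s y * b i k s y) / 2)) := by
        -- The dissipation has a favourable sign and is discarded.
        have h1 : 0 ≤ 2 * ν * ∑ k, pd k (b i j s) y * pd k (b i j s) y :=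
          mul_nonneg (by linarith) (Finset.sum_nonneg fun k _ => mul_self_nonneg _)
        have h2 : b i j s y * Gam ν u (b i j) s y ≤
            ∑ k, (K * ((b i j s y * b i j s y + b k j s y * b k j s y) / 2) +
            K * ((b i j s y * b i j s y + b i k s y * b i k s y) / 2)) := by
          rw [Gam_cauchyDefect hu hA hv hsT, ← Finset.sum_neg_distrib, Finset.mul_sum]
          refine Finset.sum_le_sum fun k _ => ?_
          have t1 := abs_mul_mul_le (b := b i j s y) (c := b k j s y)
            (hK s ⟨hs.1.le, hs.2⟩ y i k)
          have t2 := abs_mul_mul_le (b := b i j s y) (c := b i k s y)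
            (hK s ⟨hs.1.le, hs.2⟩ y j k)
          linarith
        linarith
      rw [e]
      refine (Finset.sum_le_sum fun i _ => Finset.sum_le_sum fun j _ => hterm i j).trans_eq ?_
      -- Each of the four squares, summed over `i`, `j`, `k`, gives `3 h`; hence `2 · K/2 · 12 h =
      -- 12 K h`.
      simp only [Fin.sum_univ_three]
      ring
  have hnn (i) : 0 ≤ ∑ j, b i j t x * b i j t x :=
    Finset.sum_nonneg fun j _ => mul_self_nonneg _
  have h0 : h t x = 0 := le_antisymm hle (Finset.sum_nonneg fun i _ => hnn i)
  have h1 := (Finset.sum_eq_zero_iff_of_nonneg fun i _ => hnn i).1 h0 i (Finset.mem_univ i)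
  have h2 := (Finset.sum_eq_zero_iff_of_nonneg fun j _ => mul_self_nonneg _).1 h1 j
    (Finset.mem_univ j)
  exact mul_self_eq_zero.1 h2

end Evolution

/-! ### The Cauchy formula -/

lemma det_submatrix_rows (M : Matrix (Fin 3) (Fin 3) ℝ) (i j k : Fin 3) :
    (M.submatrix ![i, j, k] id).det = M i 0 * (M j 1 * M k 2 - M j 2 * M k 1) -
      M i 1 * (M j 0 * M k 2 - M j 2 * M k 0) + M i 2 * (M j 0 * M k 1 - M j 1 * M k 0) := by
  rw [Matrix.det_fin_three]
  change M i 0 * M j 1 * M k 2 - M i 0 * M j 2 * M k 1 - M i 1 * M j 0 * M k 2 +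
    M i 1 * M j 2 * M k 0 + M i 2 * M j 0 * M k 1 - M i 2 * M j 1 * M k 0 = _
  ring

lemma sum_eps_zero (F : Fin 3 → Fin 3 → ℝ) : ∑ i, ∑ j, eps 0 i j * F i j = F 1 2 - F 2 1 := by
  simp only [eps, det_submatrix_rows]
  simp [Fin.sum_univ_three]
  ring

lemma sum_eps_one (F : Fin 3 → Fin 3 → ℝ) : ∑ i, ∑ j, eps 1 i j * F i j = F 2 0 - F 0 2 := by
  simp only [eps, det_submatrix_rows]
  simp [Fin.sum_univ_three]
  ring

lemma sum_eps_two (F : Fin 3 → Fin 3 → ℝ) : ∑ i, ∑ j, eps 2 i j * F i j = F 0 1 - F 1 0 := by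
  simp only [eps, det_submatrix_rows]
  simp [Fin.sum_univ_three]
  ring

/-- If `∇u - (∇u)ᵀ` has entries `∂_i v_m ∂_j A^m - ∂_j v_m ∂_i A^m`, then the vorticity is given by
the Cauchy formula. -/
lemma cauchy_formula {A v u : E3 → E3} {x : E3} (hA : IsUnit (gradMat A x))
    (h : ∀ i j, ∑ m, (pd i (fun y => v y m) x * pd j (fun y => A y m) x -
      pd j (fun y => v y m) x * pd i (fun y => A y m) x) -
      (pd i (fun y => u y j) x - pd j (fun y => u y i) x) = 0) :
    (∀ q : Fin 3, curl u x q = 1 / 2 * ∑ i, ∑ j, eps q i j *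
      det3 (labelCurl A v x) (pdVec i A x) (pdVec j A x)) ∧
    curl u x = (gradMat A x).det • ((gradMat A x)⁻¹).mulVec (labelCurl A v x) := by
  have hdet : (gradMat A x).det ≠ 0 := ((Matrix.isUnit_iff_isUnit_det _).1 hA).ne_zero
  -- The adjugate is polynomial in `∇A`, so both forms of the formula reduce to ring identities.
  have hadj : (gradMat A x).det • ((gradMat A x)⁻¹).mulVec (labelCurl A v x) =
      (gradMat A x).adjugate.mulVec (labelCurl A v x) := by
    rw [Matrix.inv_def, Ring.inverse_eq_inv', Matrix.smul_mulVec, smul_smul,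
      mul_inv_cancel₀ hdet, one_smul]
  have hv (i m) := (sum_labelPd_mul_pd hA (fun y => v y m) i).symm
  have hw (i j) : pd i (fun y => u y j) x - pd j (fun y => u y i) x =
      ∑ m, (pd i (fun y => v y m) x * pd j (fun y => A y m) x -
      pd j (fun y => v y m) x * pd i (fun y => A y m) x) := by linarith [h i j]
  have c0 : curl u x 0 = pd 1 (fun y => u y 2) x - pd 2 (fun y => u y 1) x := sum_eps_zero _
  have c1 : curl u x 1 = pd 2 (fun y => u y 0) x - pd 0 (fun y => u y 2) x := sum_eps_one _
  have c2 : curl u x 2 = pd 0 (fun y => u y 1) x - pd 1 (fun y => u y 0) x := sum_eps_two _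
  have z0 : labelCurl A v x 0 =
      labelPd A 1 (fun y => v y 2) x - labelPd A 2 (fun y => v y 1) x := sum_eps_zero _
  have z1 : labelCurl A v x 1 =
      labelPd A 2 (fun y => v y 0) x - labelPd A 0 (fun y => v y 2) x := sum_eps_one _
  have z2 : labelCurl A v x 2 =
      labelPd A 0 (fun y => v y 1) x - labelPd A 1 (fun y => v y 0) x := sum_eps_two _
  have hmat : curl u x = (gradMat A x).adjugate.mulVec (labelCurl A v x) := by
    funext q
    fin_cases q
    · simp [c0, hw, hv, Matrix.adjugate_fin_three, Matrix.mulVec, dotProduct, Fin.sum_univ_three,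
        z0, z1, z2, gradMat]
      ring
    · simp [c1, hw, hv, Matrix.adjugate_fin_three, Matrix.mulVec, dotProduct, Fin.sum_univ_three,
        z0, z1, z2, gradMat]
      ring
    · simp [c2, hw, hv, Matrix.adjugate_fin_three, Matrix.mulVec, dotProduct, Fin.sum_univ_three,
        z0, z1, z2, gradMat]
      ring
  refine ⟨fun q => ?_, hmat.trans hadj.symm⟩
  rw [hmat]
  have hd (a b c : Fin 3 → ℝ) : det3 a b c = a 0 * b 1 * c 2 - a 0 * b 2 * c 1 - a 1 * b 0 * c 2 +
      a 1 * b 2 * c 0 + a 2 * b 0 * c 1 - a 2 * b 1 * c 0 := by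
    simp [det3, Matrix.det_fin_three]
  fin_cases q
  -- The determinant is antisymmetric in its last two rows, so the two permutations contribute
  -- equally and absorb the `1 / 2`; expanding along `ζ` gives a row of the adjugate.
  · refine Eq.trans ?_ (congrArg (1 / 2 * ·) (sum_eps_zero _).symm)
    simp [Matrix.adjugate_fin_three, Matrix.mulVec, dotProduct, Fin.sum_univ_three,
      gradMat, hd, pdVec]
    ring
  · refine Eq.trans ?_ (congrArg (1 / 2 * ·) (sum_eps_one _).symm)
    simp [Matrix.adjugate_fin_three, Matrix.mulVec, dotProduct, Fin.sum_univ_three,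
      gradMat, hd, pdVec]
    ring
  · refine Eq.trans ?_ (congrArg (1 / 2 * ·) (sum_eps_two _).symm)
    simp [Matrix.adjugate_fin_three, Matrix.mulVec, dotProduct, Fin.sum_univ_three,
      gradMat, hd, pdVec]
    ring

end DiffusiveLagrangian

theorem theorem7 (ν T : ℝ) (hν : 0 < ν) (u A v : ℝ → DiffusiveLagrangian.E3 → DiffusiveLagrangian.E3)
    (p : ℝ → DiffusiveLagrangian.E3 → ℝ)
    (hu : DiffusiveLagrangian.NavierStokes ν T u p)
    (hA : DiffusiveLagrangian.DiffusiveLabel ν T u A)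
    (hv : DiffusiveLagrangian.VirtualVelocity ν T u A v) :
    ∀ t ∈ Set.Ico 0 T, ∀ x : DiffusiveLagrangian.E3,
      (∀ q : Fin 3, DiffusiveLagrangian.curl (u t) x q =
        1 / 2 * ∑ i, ∑ j, DiffusiveLagrangian.eps q i j *
          DiffusiveLagrangian.det3 (DiffusiveLagrangian.labelCurl (A t) (v t) x)
            (DiffusiveLagrangian.pdVec i (A t) x) (DiffusiveLagrangian.pdVec j (A t) x)) ∧
      DiffusiveLagrangian.curl (u t) x =
        (DiffusiveLagrangian.gradMat (A t) x).det •
          ((DiffusiveLagrangian.gradMat (A t) x)⁻¹).mulVec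
            (DiffusiveLagrangian.labelCurl (A t) (v t) x) := by
  intro t ht x
  exact DiffusiveLagrangian.cauchy_formula (hA.invertible t ht x) fun i j =>
    DiffusiveLagrangian.cauchyDefect_eq_zero hν.le hu hA hv ht x i j
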